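/- Let $(\mathcal C,\mathbb E,\mathfrak s)$ be an extriangulated category (in the sense of Nakaoka and Palu) which has all small coproducts and satisfies Condition (WIC): if $gf$ is an inflation then $f$ is an inflation, and if $gf$ is a deflation then $g$ is a deflation. Let $\xi$ be a proper class of $\mathbb E$-triangles, i.e. a class of $\mathbb E$-triangles that is closed under isomorphisms, finite coproducts, base change and cobase change, contains all split $\mathbb E$-triangles, and is saturated: whenever $A_1\to B_1\xrightarrow{y_1} C\overset{\delta_1}{\dashrightarrow}$ and $A_2\to B_2\xrightarrow{y_2} C\overset{\delta_2}{\dashrightarrow}$ are $\mathbb E$-triangles such that the second one and an $\mathbb E$-triangle $A_1\to M\to B_2\overset{y_2^*\delta_1}{\dashrightarrow}$ lie in $\xi$, the first one lies in $\xi$. An object $P$ is $\xi$-projective if $0\to\mathcal C(P,A)\to\mathcal C(P,B)\to\mathcal C(P,C)\to0$ is exact for every $\mathbb E$-triangle $A\to B\to C\dashrightarrow$ in $\xi$; dually, $I$ is $\xi$-injective if $0\to\mathcal C(C,I)\to\mathcal C(B,I)\to\mathcal C(A,I)\to0$ is always exact. Write $\mathcal P(\xi)$ for the class of $\xi$-projective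 objects. Assume that $\mathcal C$ has enough $\xi$-projectives (each object $A$ has an $\mathbb E$-triangle $K\to P\to A\dashrightarrow$ in $\xi$ with $P$ $\xi$-projective) and enough $\xi$-injectives (each $A$ has an $\mathbb E$-triangle $A\to I\to K\dashrightarrow$ in $\xi$ with $I$ $\xi$-injective), and that $\mathcal P(\xi)$ generates $\mathcal C$: if $\mathcal C(P,X)=0$ for all $P\in\mathcal P(\xi)$, then $X=0$. Let $\xi xt^n_\xi(M,N)=H^n(\mathcal C(\mathbf P,N))$, where $\mathbf P\to M$ is a $\xi$-projective resolution, i.e. a complex of $\xi$-projective objects $P_n$, $n\ge 0$, spliced from $\mathbb E$-triangles $K_{n+1}\to P_n\to K_n\dashrightarrow$ in $\xi$ with $K_0=M$. Let $\operatorname{Add}T$ be the class of direct summands of coproducts $T^{(\lambda)}$ of copies of $T$. A non-zero object $T$ is called $\xi$-tilting if (T1) $\xi\text{-pd}\,T\le1$, i.e. $T$ is $\xi$-projective or there is an $\mathbb E$-triangle $P_1\to P_0\to T\dashrightarrow$ in $\xi$ with $P_0,P_1\in\mathcal P(\xi)$; (T2) $\xi xt^1_\xi(T,T^{(\lambda)})=0$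 for every cardinal $\lambda$; (T3) for each $P\in\mathcal P(\xi)$ there is an $\mathbb E$-triangle $P\to T_0\to T_1\dashrightarrow$ in $\xi$ with $T_0,T_1\in\operatorname{Add}T$. Let $\operatorname{Pres}^1_{\mathcal P(\xi)}(\operatorname{Add}T)$ be the class of objects $M$ for which there is an $\mathbb E$-triangle $K_1\to Y_0\to M\dashrightarrow$ in $\xi$ with $Y_0\in\operatorname{Add}T$, and let $\operatorname{Pres}^2_{\mathcal P(\xi)}(\operatorname{Add}T)$ be the class of those $M$ for which such an $\mathbb E$-triangle exists with, in addition, $K_1\in\operatorname{Pres}^1_{\mathcal P(\xi)}(\operatorname{Add}T)$. If $T$ is a $\xi$-tilting object, then $$\operatorname{Pres}^1_{\mathcal P(\xi)}(\operatorname{Add}T)=\operatorname{Pres}^2_{\mathcal P(\xi)}(\operatorname{Add}T).$$ -/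

import Mathlib

open CategoryTheory CategoryTheory.Limits Opposite

universe w v u

namespace Extri

variable {C : Type u} [Category.{v} C] [Preadditive C] [HasBinaryBiproducts C]

/-! ## Extensions of a bifunctor -/

section Extensions

variable (E : Cᵒᵖ ⥤ C ⥤ AddCommGrpCat.{w})

/-- The abelian group `𝔼(X, A)` of `𝔼`-extensions of `X` by `A`. -/
abbrev ExtGrp (X A : C) : Type w := (E.obj (op X)).obj A

variable {E}

/-- `a_* δ = 𝔼(X, a)(δ)`. -/
def push {X A A' : C} (a : A ⟶ A') (δ : ExtGrp E X A) : ExtGrp E X A' :=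
  ((E.obj (op X)).map a).hom δ

/-- `c^* δ = 𝔼(c, A)(δ)`. -/
def pull {X X' A : C} (c : X' ⟶ X) (δ : ExtGrp E X A) : ExtGrp E X' A :=
  ((E.map c.op).app A).hom δ

/-- The direct sum `δ ⊕ δ' ∈ 𝔼(X ⊕ X', A ⊕ A')` of two extensions. -/
noncomputable def extSum {X X' A A' : C} (δ : ExtGrp E X A) (δ' : ExtGrp E X' A') :
    ExtGrp E (X ⊞ X') (A ⊞ A') :=
  pull biprod.fst (push biprod.inl δ) + pull biprod.snd (push biprod.inr δ')

end Extensions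

/-- A sequence `A ⟶ B ⟶ X` of morphisms with prescribed end terms. -/
structure Seq (A X : C) where
  B : C
  x : A ⟶ B
  y : B ⟶ X

/-- Equivalence of sequences: an isomorphism of middle terms, compatible with the identities of
the end terms. -/
def Seq.Equivalent {A X : C} (S S' : Seq A X) : Prop :=
  ∃ b : S.B ≅ S'.B, S.x ≫ b.hom = S'.x ∧ b.hom ≫ S'.y = S.y

instance Seq.setoid (A X : C) : Setoid (Seq A X) where
  r := Seq.Equivalent
  iseqv :=
    { refl := fun S => ⟨Iso.refl _, by simp, by simp⟩
      symm := by
        rintro S S' ⟨b, h1, h2⟩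
        exact ⟨b.symm, by simp [← h1], by simp [← h2]⟩
      trans := by
        rintro S S' S'' ⟨b, h1, h2⟩ ⟨b', h1', h2'⟩
        exact ⟨b ≪≫ b', by simp [← h1', ← h1], by simp [← h2, ← h2']⟩ }

/-- The equivalence class `[A ⟶ B ⟶ X]`. -/
def seqClass {A B X : C} (x : A ⟶ B) (y : B ⟶ X) : Quotient (Seq.setoid A X) :=
  Quotient.mk _ ⟨B, x, y⟩

variable (C) in
/-- An extriangulated structure `(𝔼, 𝔰)` on the additive category `C`. -/
structure ExtriangulatedStructure where
  /-- the bifunctor `𝔼` -/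
  E : Cᵒᵖ ⥤ C ⥤ AddCommGrpCat.{w}
  /-- (ET1): `𝔼` is additive in the second variable -/
  additive_right : ∀ X : Cᵒᵖ, (E.obj X).Additive
  /-- (ET1): `𝔼` is additive in the first variable -/
  additive_left : ∀ A : C, (E.flip.obj A).Additive
  /-- the correspondence `𝔰` -/
  s : ∀ {A X : C}, ExtGrp E X A → Quotient (Seq.setoid A X)
  /-- (ET2): `𝔰` is a realization, i.e. morphisms of extensions lift to middle terms -/
  s_realization : ∀ {A B X A' B' X' : C} (x : A ⟶ B) (y : B ⟶ X) (δ : ExtGrp E X A)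
    (x' : A' ⟶ B') (y' : B' ⟶ X') (δ' : ExtGrp E X' A'),
    s δ = seqClass x y → s δ' = seqClass x' y' →
    ∀ (a : A ⟶ A') (c : X ⟶ X'), push a δ = pull c δ' →
      ∃ b : B ⟶ B', x ≫ b = a ≫ x' ∧ y ≫ c = b ≫ y'
  /-- (ET2): the realization is additive, on zero extensions -/
  s_zero : ∀ A X : C, s (0 : ExtGrp E X A) = seqClass (biprod.inl : A ⟶ A ⊞ X) biprod.snd
  /-- (ET2): the realization is additive, on direct sums -/
  s_sum : ∀ {A B X A' B' X' : C} (x : A ⟶ B) (y : B ⟶ X) (δ : ExtGrp E X A)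
    (x' : A' ⟶ B') (y' : B' ⟶ X') (δ' : ExtGrp E X' A'),
    s δ = seqClass x y → s δ' = seqClass x' y' →
      s (extSum δ δ') = seqClass (biprod.map x x') (biprod.map y y')
  /-- (ET3) -/
  et3 : ∀ {A B X A' B' X' : C} (x : A ⟶ B) (y : B ⟶ X) (δ : ExtGrp E X A)
    (x' : A' ⟶ B') (y' : B' ⟶ X') (δ' : ExtGrp E X' A'),
    s δ = seqClass x y → s δ' = seqClass x' y' →
    ∀ (a : A ⟶ A') (b : B ⟶ B'), x ≫ b = a ≫ x' →
      ∃ c : X ⟶ X', push a δ = pull c δ' ∧ y ≫ c = b ≫ y'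
  /-- (ET3)ᵒᵖ -/
  et3op : ∀ {A B X A' B' X' : C} (x : A ⟶ B) (y : B ⟶ X) (δ : ExtGrp E X A)
    (x' : A' ⟶ B') (y' : B' ⟶ X') (δ' : ExtGrp E X' A'),
    s δ = seqClass x y → s δ' = seqClass x' y' →
    ∀ (b : B ⟶ B') (c : X ⟶ X'), y ≫ c = b ≫ y' →
      ∃ a : A ⟶ A', push a δ = pull c δ' ∧ x ≫ b = a ≫ x'
  /-- (ET4) -/
  et4 : ∀ {A B D Z F : C} (f : A ⟶ B) (f' : B ⟶ D) (δ : ExtGrp E D A)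
    (g : B ⟶ Z) (g' : Z ⟶ F) (δ' : ExtGrp E F B),
    s δ = seqClass f f' → s δ' = seqClass g g' →
      ∃ (G : C) (h' : Z ⟶ G) (d : D ⟶ G) (e : G ⟶ F) (δ'' : ExtGrp E G A),
        f' ≫ d = g ≫ h' ∧ h' ≫ e = g' ∧ s δ'' = seqClass (f ≫ g) h' ∧
        s (push f' δ') = seqClass d e ∧ pull d δ'' = δ ∧ push f δ'' = pull e δ'
  /-- (ET4)ᵒᵖ -/
  et4op : ∀ {D A B F Z : C} (f' : D ⟶ A) (f : A ⟶ B) (δ : ExtGrp E B D)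
    (g' : F ⟶ B) (g : B ⟶ Z) (δ' : ExtGrp E Z F),
    s δ = seqClass f' f → s δ' = seqClass g' g →
      ∃ (G : C) (d : D ⟶ G) (e : G ⟶ F) (h' : G ⟶ A) (δ'' : ExtGrp E Z G),
        d ≫ h' = f' ∧ h' ≫ f = e ≫ g' ∧ s δ'' = seqClass h' (f ≫ g) ∧
        s (pull g' δ) = seqClass d e ∧ push e δ'' = δ' ∧ push d δ = pull g δ''

variable (𝓔 : ExtriangulatedStructure.{w} C)

/-- `A ⟶ B ⟶ X ⇢ δ` is an `𝔼`-triangle: the sequence `A ⟶ B ⟶ X` realizes `δ`. -/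
def ExtriangulatedStructure.Realizes {A B X : C} (x : A ⟶ B) (y : B ⟶ X)
    (δ : ExtGrp 𝓔.E X A) : Prop :=
  𝓔.s δ = seqClass x y

/-- `x` is an inflation if it is the first morphism of an `𝔼`-triangle. -/
def IsInflation {A B : C} (x : A ⟶ B) : Prop :=
  ∃ (X : C) (y : B ⟶ X) (δ : ExtGrp 𝓔.E X A), 𝓔.Realizes x y δ

/-- `y` is a deflation if it is the second morphism of an `𝔼`-triangle. -/
def IsDeflation {B X : C} (y : B ⟶ X) : Prop :=
  ∃ (A : C) (x : A ⟶ B) (δ : ExtGrp 𝓔.E X A), 𝓔.Realizes x y δ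

/-- Condition (WIC). -/
structure WIC : Prop where
  inflation : ∀ {A B X : C} (f : A ⟶ B) (g : B ⟶ X), IsInflation 𝓔 (f ≫ g) → IsInflation 𝓔 f
  deflation : ∀ {A B X : C} (f : A ⟶ B) (g : B ⟶ X), IsDeflation 𝓔 (f ≫ g) → IsDeflation 𝓔 g

/-- An `𝔼`-triangle `A ⟶ B ⟶ X ⇢ δ`. -/
structure ETriangle where
  {A : C}
  {B : C}
  {X : C}
  x : A ⟶ B
  y : B ⟶ X
  δ : ExtGrp 𝓔.E X A
  realizes : 𝓔.Realizes x y δ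

variable {𝓔}

/-- Isomorphism of `𝔼`-triangles. -/
def ETriangle.Isomorphic (t t' : ETriangle 𝓔) : Prop :=
  ∃ (a : t.A ≅ t'.A) (b : t.B ≅ t'.B) (c : t.X ≅ t'.X),
    t.x ≫ b.hom = a.hom ≫ t'.x ∧ t.y ≫ c.hom = b.hom ≫ t'.y ∧
      push a.hom t.δ = pull c.hom t'.δ

/-- The direct sum (binary coproduct) of two `𝔼`-triangles. -/
noncomputable def ETriangle.sum (t t' : ETriangle 𝓔) : ETriangle 𝓔 where
  x := biprod.map t.x t'.x
  y := biprod.map t.y t'.y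
  δ := extSum t.δ t'.δ
  realizes := 𝓔.s_sum _ _ _ _ _ _ t.realizes t'.realizes

/-- A proper class of `𝔼`-triangles. -/
structure IsProperClass (ξ : Set (ETriangle 𝓔)) : Prop where
  /-- closed under isomorphisms -/
  iso_mem : ∀ t t' : ETriangle 𝓔, t.Isomorphic t' → t ∈ ξ → t' ∈ ξ
  /-- closed under finite coproducts (the empty one is a split triangle) -/
  sum_mem : ∀ t t' : ETriangle 𝓔, t ∈ ξ → t' ∈ ξ → t.sum t' ∈ ξ
  /-- contains the split `𝔼`-triangles -/
  split_mem : ∀ t : ETriangle 𝓔, t.δ = 0 → t ∈ ξ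
  /-- closed under base change -/
  base_change : ∀ t ∈ ξ, ∀ {B' X' : C} (c : X' ⟶ t.X) (x' : t.A ⟶ B') (y' : B' ⟶ X')
    (h : 𝓔.Realizes x' y' (pull c t.δ)), ETriangle.mk x' y' (pull c t.δ) h ∈ ξ
  /-- closed under cobase change -/
  cobase_change : ∀ t ∈ ξ, ∀ {A' B' : C} (a : t.A ⟶ A') (x' : A' ⟶ B') (y' : B' ⟶ t.X)
    (h : 𝓔.Realizes x' y' (push a t.δ)), ETriangle.mk x' y' (push a t.δ) h ∈ ξ
  /-- saturated: if `A₂ ⟶ B₂ ⟶ X ⇢ δ₂` and `A₁ ⟶ M ⟶ B₂ ⇢ y₂^* δ₁` lie in `ξ`, then so does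
  `A₁ ⟶ B₁ ⟶ X ⇢ δ₁` -/
  saturated : ∀ {A₁ B₁ A₂ B₂ X M : C} (x₁ : A₁ ⟶ B₁) (y₁ : B₁ ⟶ X) (δ₁ : ExtGrp 𝓔.E X A₁)
    (h₁ : 𝓔.Realizes x₁ y₁ δ₁) (x₂ : A₂ ⟶ B₂) (y₂ : B₂ ⟶ X) (δ₂ : ExtGrp 𝓔.E X A₂)
    (h₂ : 𝓔.Realizes x₂ y₂ δ₂) (m₁ : A₁ ⟶ M) (e₁ : M ⟶ B₂)
    (h : 𝓔.Realizes m₁ e₁ (pull y₂ δ₁)),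
    ETriangle.mk x₂ y₂ δ₂ h₂ ∈ ξ → ETriangle.mk m₁ e₁ (pull y₂ δ₁) h ∈ ξ →
      ETriangle.mk x₁ y₁ δ₁ h₁ ∈ ξ

variable (ξ : Set (ETriangle 𝓔))

/-- `ξ`-projective objects: `0 → C(P, A) → C(P, B) → C(P, X) → 0` is exact for all triangles
in `ξ`. -/
def IsXiProjective (P : C) : Prop :=
  ∀ t ∈ ξ, Function.Injective (fun f : P ⟶ t.A => f ≫ t.x) ∧
    Function.Exact (fun f : P ⟶ t.A => f ≫ t.x) (fun f : P ⟶ t.B => f ≫ t.y) ∧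
    Function.Surjective (fun f : P ⟶ t.B => f ≫ t.y)

/-- `ξ`-injective objects: `0 → C(X, I) → C(B, I) → C(A, I) → 0` is exact for all triangles
in `ξ`. -/
def IsXiInjective (I : C) : Prop :=
  ∀ t ∈ ξ, Function.Injective (fun f : t.X ⟶ I => t.y ≫ f) ∧
    Function.Exact (fun f : t.X ⟶ I => t.y ≫ f) (fun f : t.B ⟶ I => t.x ≫ f) ∧
    Function.Surjective (fun f : t.B ⟶ I => t.x ≫ f)

/-- There is an `𝔼`-triangle `A ⟶ B ⟶ X ⇢` in `ξ` with the given terms. -/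
def HasTriangle (A B X : C) : Prop :=
  ∃ (x : A ⟶ B) (y : B ⟶ X) (δ : ExtGrp 𝓔.E X A) (h : 𝓔.Realizes x y δ),
    ETriangle.mk x y δ h ∈ ξ

def EnoughXiProjectives : Prop :=
  ∀ A : C, ∃ K P : C, IsXiProjective ξ P ∧ HasTriangle ξ K P A

def EnoughXiInjectives : Prop :=
  ∀ A : C, ∃ I K : C, IsXiInjective ξ I ∧ HasTriangle ξ A I K

/-- `𝓟(ξ)` is a generating subcategory: an object admitting only zero morphisms from
`ξ`-projective objects is zero. -/
def XiProjectivesGenerate : Prop :=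
  ∀ X : C, (∀ P : C, IsXiProjective ξ P → ∀ f : P ⟶ X, f = 0) → IsZero X

/-- `ξ`-pd `A ≤ n`. -/
def XiPdLE : ℕ → C → Prop
  | 0, A => IsXiProjective ξ A
  | n + 1, A => IsXiProjective ξ A ∨
      ∃ K P : C, IsXiProjective ξ P ∧ HasTriangle ξ K P A ∧ XiPdLE n K

/-- A `ξ`-projective resolution `⋯ ⟶ P₁ ⟶ P₀ ⟶ M`: a complex of `ξ`-projective objects which is
spliced from `𝔼`-triangles `Kₙ₊₁ ⟶ Pₙ ⟶ Kₙ ⇢` in `ξ` with `K₀ = M`. -/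
structure XiProjectiveResolution (M : C) where
  complex : ChainComplex C ℕ
  projective : ∀ n, IsXiProjective ξ (complex.X n)
  K : ℕ → C
  g : ∀ n, K (n + 1) ⟶ complex.X n
  f : ∀ n, complex.X n ⟶ K n
  δ : ∀ n, ExtGrp 𝓔.E (K n) (K (n + 1))
  realizes : ∀ n, 𝓔.Realizes (g n) (f n) (δ n)
  mem : ∀ n, ETriangle.mk (g n) (f n) (δ n) (realizes n) ∈ ξ
  d_eq : ∀ n, complex.d (n + 1) n = f (n + 1) ≫ g n
  /-- the identification of the zeroth term with `M` -/
  iso : K 0 ≅ M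

variable {ξ} in
/-- The `ξ`-cohomology group `ξxtⁿ(M, N) = Hⁿ(C(P, N))`, computed with the chosen
`ξ`-projective resolution `P` of `M`. -/
noncomputable def XiProjectiveResolution.xiExt {M : C} (P : XiProjectiveResolution ξ M) (n : ℕ)
    (N : C) : AddCommGrpCat.{v} :=
  (((preadditiveYoneda.obj N).rightOp.mapHomologicalComplex _).obj P.complex).unop.homology n

/-- `ξxtⁿ(M, N) = 0`. The group does not depend, up to isomorphism, on the chosen
`ξ`-projective resolution of `M`. -/
def XiExtVanishes (n : ℕ) (M N : C) : Prop :=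
  ∃ P : XiProjectiveResolution ξ M, IsZero (P.xiExt n N)

/-- `Add T`: the direct summands of the coproducts `T^(J)`. -/
def AddClosure [HasCoproducts.{v} C] (T : C) : ObjectProperty C :=
  fun M => ∃ J : Type v, Nonempty (Retract M (∐ fun _ : J => T))

/-- `ξ`-tilting objects. -/
structure IsXiTilting [HasCoproducts.{v} C] (T : C) : Prop where
  nonzero : ¬ IsZero T
  /-- (T1) -/
  pd_le_one : XiPdLE ξ 1 T
  /-- (T2) -/
  self_orthogonal : ∀ J : Type v, XiExtVanishes ξ 1 T (∐ fun _ : J => T)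
  /-- (T3) -/
  coresolution : ∀ P : C, IsXiProjective ξ P →
    ∃ T₀ T₁ : C, AddClosure T T₀ ∧ AddClosure T T₁ ∧ HasTriangle ξ P T₀ T₁

/-- `Pres¹(Add T)`: the objects `M` with a triangle `K₁ ⟶ Y₀ ⟶ M ⇢` in `ξ`, `Y₀ ∈ Add T`. -/
def Pres₁ [HasCoproducts.{v} C] (T : C) : ObjectProperty C :=
  fun M => ∃ K₁ Y₀ : C, AddClosure T Y₀ ∧ HasTriangle ξ K₁ Y₀ M

/-- `Pres²(Add T)`: the objects `M` with a triangle `K₁ ⟶ Y₀ ⟶ M ⇢` in `ξ`, `Y₀ ∈ Add T` and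
`K₁ ∈ Pres¹(Add T)`. -/
def Pres₂ [HasCoproducts.{v} C] (T : C) : ObjectProperty C :=
  fun M => ∃ K₁ Y₀ : C, AddClosure T Y₀ ∧ Pres₁ ξ T K₁ ∧ HasTriangle ξ K₁ Y₀ M

end Extri

/-! Only the passage from Pres¹ to Pres² needs an argument. If `M` is in Pres¹, the evaluation map
from the coproduct of copies of `T` indexed by `T ⟶ M` is a `ξ`-deflation, by
`IsXiDeflation.of_comp`. Let `L` be its kernel term. Each `ξ`-extension of `T` by `L` dies in the
coproduct by (T2), so it is pulled back along some `c : T ⟶ M`; as `c` factors through the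
evaluation map, the extension splits. By (T3), an object by which all `ξ`-extensions of `T` split is
in Pres¹ (`IsXiTilting.pres₁_of_extensionsSplit`), so `L` is. -/

namespace Extri

variable {C : Type u} [Category.{v} C]

/-! ### Functoriality of push and pull -/

section Functoriality

variable {E : Cᵒᵖ ⥤ C ⥤ AddCommGrpCat.{w}}

@[simp]
lemma push_id {X A : C} (δ : ExtGrp E X A) : push (𝟙 A) δ = δ := by
  simp [push]

@[simp]
lemma pull_id {X A : C} (δ : ExtGrp E X A) : pull (𝟙 X) δ = δ := by
  simp [pull]

lemma push_comp {X A A' A'' : C} (a : A ⟶ A') (a' : A' ⟶ A'') (δ : ExtGrp E X A) :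
    push (a ≫ a') δ = push a' (push a δ) := by
  simp [push]

lemma pull_comp {X X' X'' A : C} (c : X' ⟶ X) (c' : X'' ⟶ X') (δ : ExtGrp E X A) :
    pull (c' ≫ c) δ = pull c' (pull c δ) := by
  simp [pull]

lemma push_pull {X X' A A' : C} (a : A ⟶ A') (c : X' ⟶ X) (δ : ExtGrp E X A) :
    push a (pull c δ) = pull c (push a δ) := by
  simp [push, pull]

@[simp]
lemma push_zero {X A A' : C} (a : A ⟶ A') : push a (0 : ExtGrp E X A) = 0 := by
  simp [push]

@[simp]
lemma pull_zero {X X' A : C} (c : X' ⟶ X) : pull c (0 : ExtGrp E X A) = 0 := by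
  simp [pull]

end Functoriality

/-! ### Maps out of Add T -/

section AddClosure

variable [HasCoproducts.{v} C]

lemma addClosure_sigma (T : C) (J : Type v) : AddClosure T (∐ fun _ : J => T) :=
  ⟨J, ⟨Retract.refl _⟩⟩

/-- Each component `T ⟶ M` of the map is itself an index of the coproduct, so it is sent to the
summand that it names. -/
lemma AddClosure.exists_factor {T Y M : C} (hY : AddClosure T Y) (f : Y ⟶ M) :
    ∃ g : Y ⟶ ∐ fun _ : (T ⟶ M) => T, g ≫ Sigma.desc (fun p : T ⟶ M => p) = f := by
  obtain ⟨J, ⟨r⟩⟩ := hY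
  refine ⟨r.i ≫ Sigma.desc fun j =>
    Sigma.ι (fun _ : (T ⟶ M) => T) (Sigma.ι (fun _ : J => T) j ≫ r.r ≫ f), ?_⟩
  have h : (Sigma.desc fun j => Sigma.ι (fun _ : (T ⟶ M) => T)
      (Sigma.ι (fun _ : J => T) j ≫ r.r ≫ f)) ≫ Sigma.desc (fun p : T ⟶ M => p) = r.r ≫ f :=
    Sigma.hom_ext _ _ fun j => by simp
  rw [Category.assoc, h, r.retract_assoc]

end AddClosure

variable [Preadditive C] [HasBinaryBiproducts C]

/-! ### Exactness properties of triangles -/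

section Triangles

variable {𝓔 : ExtriangulatedStructure.{w} C}

lemma exists_realizes {X A : C} (δ : ExtGrp 𝓔.E X A) :
    ∃ (B : C) (x : A ⟶ B) (y : B ⟶ X), 𝓔.Realizes x y δ := by
  obtain ⟨S, hS⟩ := Quotient.exists_rep (𝓔.s δ)
  exact ⟨S.B, S.x, S.y, hS.symm⟩

/-- Map the split triangle on `A ⊞ B` to the given one by (ET3); the induced map of third terms is
forced to be `y`. -/
lemma ExtriangulatedStructure.Realizes.comp_eq_zero_and_pull_eq_zero {A B X : C} {x : A ⟶ B}
    {y : B ⟶ X} {δ : ExtGrp 𝓔.E X A} (h : 𝓔.Realizes x y δ) : x ≫ y = 0 ∧ pull y δ = 0 := by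
  obtain ⟨c, hc, hc'⟩ := 𝓔.et3 _ _ _ x y δ (𝓔.s_zero A B) h (𝟙 A) (biprod.desc x (𝟙 B)) (by simp)
  have hy : c = y := by simpa using biprod.inr ≫= hc'
  subst hy
  exact ⟨by simpa using (biprod.inl ≫= hc').symm, by simpa using hc.symm⟩

lemma ExtriangulatedStructure.Realizes.push_eq_zero {A B X : C} {x : A ⟶ B}
    {y : B ⟶ X} {δ : ExtGrp 𝓔.E X A} (h : 𝓔.Realizes x y δ) : push x δ = 0 := by
  obtain ⟨a, ha, ha'⟩ := 𝓔.et3op x y δ _ _ _ h (𝓔.s_zero B X) (biprod.lift (𝟙 B) y) (𝟙 X) (by simp)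
  have hx : a = x := by simpa using (ha' =≫ biprod.fst).symm
  subst hx
  simpa using ha

lemma ExtriangulatedStructure.Realizes.pull_eq_zero_of_factors {A B X Z : C} {x : A ⟶ B}
    {y : B ⟶ X} {δ : ExtGrp 𝓔.E X A} (h : 𝓔.Realizes x y δ) {c : Z ⟶ X} (b : Z ⟶ B)
    (hb : b ≫ y = c) : pull c δ = 0 := by
  rw [← hb, pull_comp, h.comp_eq_zero_and_pull_eq_zero.2, pull_zero]

lemma ExtriangulatedStructure.Realizes.exists_extension {A B X A' : C} {x : A ⟶ B}
    {y : B ⟶ X} {δ : ExtGrp 𝓔.E X A} (h : 𝓔.Realizes x y δ) {a : A ⟶ A'} (ha : push a δ = 0) :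
    ∃ b : B ⟶ A', x ≫ b = a := by
  obtain ⟨b, hb, -⟩ := 𝓔.s_realization x y δ _ _ _ h (𝓔.s_zero A' X) a (𝟙 X) (by simp [ha])
  exact ⟨b ≫ biprod.fst, by simp [reassoc_of% hb]⟩

lemma ExtriangulatedStructure.Realizes.exists_lift {A B X Z : C} {x : A ⟶ B}
    {y : B ⟶ X} {δ : ExtGrp 𝓔.E X A} (h : 𝓔.Realizes x y δ) {c : Z ⟶ X} (hc : pull c δ = 0) :
    ∃ b : Z ⟶ B, b ≫ y = c := by
  obtain ⟨b, -, hb⟩ := 𝓔.s_realization _ _ _ x y δ (𝓔.s_zero A Z) h (𝟙 A) c (by simp [hc])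
  exact ⟨biprod.inr ≫ b, by simp [← hb]⟩

/-- Exactness of `C(Z, X) ⟶ 𝔼(Z, A) ⟶ 𝔼(Z, B)` at `𝔼(Z, A)`. -/
lemma ExtriangulatedStructure.Realizes.exists_eq_pull {A B X Z : C} {x : A ⟶ B}
    {y : B ⟶ X} {δ : ExtGrp 𝓔.E X A} (h : 𝓔.Realizes x y δ) {ε : ExtGrp 𝓔.E Z A}
    (hε : push x ε = 0) : ∃ c : Z ⟶ X, ε = pull c δ := by
  obtain ⟨N, u, w, huw⟩ := exists_realizes ε
  obtain ⟨b, hb⟩ := huw.exists_extension hε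
  obtain ⟨c, hc, -⟩ := 𝓔.et3 u w ε x y δ huw h (𝟙 A) b (by simp [hb])
  exact ⟨c, by simpa using hc⟩

/-! ### `ξ`-extensions, `ξ`-deflations and splitting -/

variable (ξ : Set (ETriangle 𝓔))

/-- The extension `δ` is realized by an `𝔼`-triangle in `ξ`. -/
def IsXiExtension {X A : C} (δ : ExtGrp 𝓔.E X A) : Prop :=
  ∃ (B : C) (x : A ⟶ B) (y : B ⟶ X) (h : 𝓔.Realizes x y δ), ETriangle.mk x y δ h ∈ ξ

/-- `y` is the second morphism of an `𝔼`-triangle in `ξ`. -/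
def IsXiDeflation {B X : C} (y : B ⟶ X) : Prop :=
  ∃ (A : C) (x : A ⟶ B) (δ : ExtGrp 𝓔.E X A) (h : 𝓔.Realizes x y δ), ETriangle.mk x y δ h ∈ ξ

/-- Every `𝔼`-triangle `N ⟶ B ⟶ M ⇢` in `ξ` splits. -/
def XiExtensionsSplit (M N : C) : Prop :=
  ∀ δ : ExtGrp 𝓔.E M N, IsXiExtension ξ δ → δ = 0

variable {ξ}

lemma IsXiExtension.push (hξ : IsProperClass ξ) {X A A' : C} {δ : ExtGrp 𝓔.E X A}
    (hδ : IsXiExtension ξ δ) (a : A ⟶ A') : IsXiExtension ξ (Extri.push a δ) := by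
  obtain ⟨B, x, y, h, hm⟩ := hδ
  obtain ⟨B', x', y', h'⟩ := exists_realizes (Extri.push a δ)
  exact ⟨B', x', y', h', hξ.cobase_change _ hm a x' y' h'⟩

lemma IsXiExtension.pull (hξ : IsProperClass ξ) {X X' A : C} {δ : ExtGrp 𝓔.E X A}
    (hδ : IsXiExtension ξ δ) (c : X' ⟶ X) : IsXiExtension ξ (Extri.pull c δ) := by
  obtain ⟨B, x, y, h, hm⟩ := hδ
  obtain ⟨B', x', y', h'⟩ := exists_realizes (Extri.pull c δ)
  exact ⟨B', x', y', h', hξ.base_change _ hm c x' y' h'⟩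

lemma IsXiProjective.exists_lift {P B X : C} (hP : IsXiProjective ξ P) {y : B ⟶ X}
    (hy : IsXiDeflation ξ y) (c : P ⟶ X) : ∃ b : P ⟶ B, b ≫ y = c := by
  obtain ⟨A, x, δ, h, hm⟩ := hy
  exact (hP _ hm).2.2 c

lemma IsXiProjective.extensionsSplit {P : C} (hP : IsXiProjective ξ P) (N : C) :
    XiExtensionsSplit ξ P N := by
  rintro δ ⟨B, x, y, h, hm⟩
  obtain ⟨b, hb⟩ := hP.exists_lift ⟨_, x, δ, h, hm⟩ (𝟙 P)
  simpa using h.pull_eq_zero_of_factors b hb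

/-- Dimension shift: lifting `y ≫ c` to the middle term induces a morphism of triangles, so the
extension comes from a map out of the syzygy `K`. -/
lemma IsXiProjective.exists_push_eq_pull {K P X X' N : C} (hP : IsXiProjective ξ P) {x : K ⟶ P}
    {y : P ⟶ X} {ε : ExtGrp 𝓔.E X K} (h : 𝓔.Realizes x y ε) {δ : ExtGrp 𝓔.E X' N}
    (hδ : IsXiExtension ξ δ) (c : X ⟶ X') : ∃ a : K ⟶ N, push a ε = pull c δ := by
  obtain ⟨B, x', y', h', hm⟩ := hδ
  obtain ⟨b, hb⟩ := hP.exists_lift ⟨_, x', δ, h', hm⟩ (y ≫ c)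
  obtain ⟨a, ha, -⟩ := 𝓔.et3op x y ε x' y' δ h h' b c hb.symm
  exact ⟨a, ha⟩

/-- (WIC) provides a triangle on `y`. Its pullback along `f ≫ y` splits, hence lies in `ξ`, and
saturation applies. -/
lemma IsXiDeflation.of_comp (hWIC : WIC 𝓔) (hξ : IsProperClass ξ) {Z B X : C} (f : Z ⟶ B)
    (y : B ⟶ X) (hfy : IsXiDeflation ξ (f ≫ y)) : IsXiDeflation ξ y := by
  obtain ⟨A₂, x₂, δ₂, h₂, hm₂⟩ := hfy
  obtain ⟨A, x, δ, h⟩ := hWIC.deflation f y ⟨A₂, x₂, δ₂, h₂⟩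
  have h0 : pull (f ≫ y) δ = 0 := h.pull_eq_zero_of_factors f rfl
  have hs : 𝓔.Realizes (biprod.inl : A ⟶ A ⊞ Z) biprod.snd (pull (f ≫ y) δ) := by
    rw [h0]
    exact 𝓔.s_zero A Z
  exact ⟨A, x, δ, h, hξ.saturated x y δ h x₂ (f ≫ y) δ₂ h₂ _ _ hs hm₂ (hξ.split_mem _ h0)⟩

namespace XiExtensionsSplit

lemma of_retract_left (hξ : IsProperClass ξ) {M M' N : C} (h : XiExtensionsSplit ξ M N)
    (r : Retract M' M) : XiExtensionsSplit ξ M' N := fun δ hδ => by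
  rw [← pull_id δ, ← r.retract, pull_comp, h _ (hδ.pull hξ r.r), pull_zero]

lemma of_retract_right (hξ : IsProperClass ξ) {M N N' : C} (h : XiExtensionsSplit ξ M N)
    (r : Retract N' N) : XiExtensionsSplit ξ M N' := fun δ hδ => by
  rw [← push_id δ, ← r.retract, push_comp, h _ (hδ.push hξ r.i), push_zero]

/-- Splitting means lifting the identity through `y`, and lifts on the summands glue; no infinite
coproduct of triangles is formed. -/
lemma sigma (hξ : IsProperClass ξ) {J : Type*} (M : J → C) [HasCoproduct M] {N : C}
    (h : ∀ j, XiExtensionsSplit ξ (M j) N) : XiExtensionsSplit ξ (∐ M) N := fun δ hδ => by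
  obtain ⟨B, x, y, hr⟩ := exists_realizes δ
  choose b hb using fun j => hr.exists_lift (h j _ (hδ.pull hξ (Sigma.ι M j)))
  simpa using hr.pull_eq_zero_of_factors (Sigma.desc b) (c := 𝟙 _)
    (Sigma.hom_ext _ _ fun j => by simp [hb])

/-- The functor `ξxt¹(M, -)` is right exact if `ξ`-pd `M ≤ 1`. -/
lemma of_deflation (hξ : IsProperClass ξ) {M N N' : C} (hM : XiPdLE ξ 1 M)
    (h : XiExtensionsSplit ξ M N) {y : N ⟶ N'} (hy : IsXiDeflation ξ y) :
    XiExtensionsSplit ξ M N' := by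
  obtain hM | ⟨K, P, hP, ⟨x, z, ε, hr, hm⟩, hK⟩ := hM
  · exact hM.extensionsSplit N'
  · intro δ hδ
    -- Here `δ` is a pushout of `ε` along `a : K ⟶ N'`; as `K` is `ξ`-projective, `a` lifts to `N`,
    -- where the pushout of `ε` splits.
    obtain ⟨a, ha⟩ := hP.exists_push_eq_pull hr hδ (𝟙 M)
    obtain ⟨b, rfl⟩ := IsXiProjective.exists_lift hK hy a
    rw [pull_id] at ha
    have hε : IsXiExtension ξ ε := ⟨_, x, z, hr, hm⟩
    rw [← ha, push_comp, h _ (hε.push hξ b), push_zero]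

end XiExtensionsSplit

lemma XiProjectiveResolution.exists_factor_of_isZero {M N : C} (R : XiProjectiveResolution ξ M)
    (h : IsZero (R.xiExt 1 N)) (φ : R.complex.X 1 ⟶ N) (hφ : R.complex.d 2 1 ≫ φ = 0) :
    ∃ ψ : R.complex.X 0 ⟶ N, R.complex.d 1 0 ≫ ψ = φ := by
  rw [xiExt, ← HomologicalComplex.exactAt_iff_isZero_homology,
    HomologicalComplex.exactAt_iff' _ 0 1 2 (ComplexShape.prev_eq' _ (by simp))
      (ComplexShape.next_eq' _ (by simp)), ShortComplex.ab_exact_iff] at h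
  exact h φ hφ

/-- If `ξ`-pd `M ≤ 1` and `ξxt¹(M, N) = 0`, then the triangles `N ⟶ B ⟶ M ⇢` in `ξ` split. -/
lemma XiExtVanishes.extensionsSplit {M N : C} (hM : XiPdLE ξ 1 M) (h : XiExtVanishes ξ 1 M N) :
    XiExtensionsSplit ξ M N := by
  obtain hM | ⟨K, P, hP, ⟨x, z, ε, hr, hm⟩, hK⟩ := hM
  · exact hM.extensionsSplit N
  · intro δ hδ
    obtain ⟨R, hR⟩ := h
    -- The short resolution of `M` and `R` may differ: `a` represents `δ` on the syzygy of `R`, and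
    -- `b` compares the two syzygies.
    obtain ⟨a, ha⟩ := (R.projective 0).exists_push_eq_pull (R.realizes 0) hδ R.iso.hom
    obtain ⟨b, hb⟩ := hP.exists_push_eq_pull hr ⟨_, _, _, R.realizes 0, R.mem 0⟩ R.iso.inv
    obtain ⟨ψ, hψ⟩ := R.exists_factor_of_isZero hR (R.f 1 ≫ a) (by
      rw [R.d_eq, Category.assoc,
        reassoc_of% (R.realizes 1).comp_eq_zero_and_pull_eq_zero.1, zero_comp, comp_zero])
    rw [R.d_eq, Category.assoc] at hψ
    -- The coboundary relation holds only after composing with `R.f 1`. Lifting `b` through `R.f 1`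
    -- makes it usable without cancellation.
    obtain ⟨b', rfl⟩ := IsXiProjective.exists_lift hK
      ⟨_, _, _, R.realizes 1, R.mem 1⟩ b
    calc δ = pull R.iso.inv (pull R.iso.hom δ) := by rw [← pull_comp]; simp
      _ = push ((b' ≫ R.f 1) ≫ a) ε := by rw [← ha, ← push_pull, ← hb, ← push_comp]
      _ = push (((b' ≫ R.f 1) ≫ R.g 0) ≫ ψ) ε := by simp only [Category.assoc, hψ]
      _ = 0 := by
        rw [push_comp, push_comp, hb, push_pull, (R.realizes 0).push_eq_zero, pull_zero, push_zero]

end Triangles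

/-! ### Pres¹ and splitting of `ξ`-extensions of T -/

section Tilting

variable {𝓔 : ExtriangulatedStructure.{w} C} {ξ : Set (ETriangle 𝓔)} [HasCoproducts.{v} C]

lemma XiExtensionsSplit.of_addClosure_left (hξ : IsProperClass ξ) {T M N : C}
    (h : XiExtensionsSplit ξ T N) (hM : AddClosure T M) : XiExtensionsSplit ξ M N := by
  obtain ⟨J, ⟨r⟩⟩ := hM
  exact (XiExtensionsSplit.sigma hξ _ fun _ => h).of_retract_left hξ r

variable {T : C}

/-- Splitting passes from Add T, where (T2) gives it, along `ξ`-deflations because of (T1). With the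
next lemma this characterises Pres¹. -/
lemma IsXiTilting.extensionsSplit_of_pres₁ (hξ : IsProperClass ξ) (hT : IsXiTilting ξ T) {M : C}
    (hM : Pres₁ ξ T M) : XiExtensionsSplit ξ T M := by
  obtain ⟨K, Y, ⟨J, ⟨r⟩⟩, x, y, δ, h, hm⟩ := hM
  exact (((hT.self_orthogonal J).extensionsSplit hT.pd_le_one).of_retract_right hξ r).of_deflation
    hξ hT.pd_le_one ⟨K, x, δ, h, hm⟩

lemma IsXiTilting.pres₁_of_extensionsSplit (hWIC : WIC 𝓔) (hξ : IsProperClass ξ)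
    (hproj : EnoughXiProjectives ξ) (hT : IsXiTilting ξ T) {M : C}
    (hM : XiExtensionsSplit ξ T M) : Pres₁ ξ T M := by
  obtain ⟨K, P, hP, x, p, δ, hp, hpm⟩ := hproj M
  obtain ⟨T₀, T₁, hT₀, hT₁, u, w, ε, h, hm⟩ := hT.coresolution P hP
  have hε : IsXiExtension ξ ε := ⟨_, u, w, h, hm⟩
  -- The pushout of `ε` along `p` is a `ξ`-extension of `T₁` by `M`, so it splits and `p` extends to
  -- `q : T₀ ⟶ M`; `q` is a `ξ`-deflation because `u ≫ q` is.
  obtain ⟨q, rfl⟩ := h.exists_extension (hM.of_addClosure_left hξ hT₁ _ (hε.push hξ p))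
  obtain ⟨L, t⟩ := IsXiDeflation.of_comp hWIC hξ u q ⟨K, x, δ, hp, hpm⟩
  obtain ⟨z, η, h', hm'⟩ := t
  exact ⟨L, T₀, hT₀, z, q, η, h', hm'⟩

lemma IsXiTilting.pres₂_of_pres₁ (hWIC : WIC 𝓔) (hξ : IsProperClass ξ)
    (hproj : EnoughXiProjectives ξ) (hT : IsXiTilting ξ T) {M : C} (hM : Pres₁ ξ T M) :
    Pres₂ ξ T M := by
  obtain ⟨K, Y, hY, x, y, δ, h, hm⟩ := hM
  obtain ⟨g, rfl⟩ := hY.exists_factor y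
  obtain ⟨L, z, ε, hε, hεm⟩ := IsXiDeflation.of_comp hWIC hξ g _ ⟨K, x, δ, h, hm⟩
  refine ⟨L, _, addClosure_sigma T (T ⟶ M),
    hT.pres₁_of_extensionsSplit hWIC hξ hproj fun η hη => ?_, z, _, ε, hε, hεm⟩
  -- By (T2) the image of `η` in the coproduct vanishes; the resulting `c` lifts as the inclusion of
  -- the summand indexed by `c`.
  obtain ⟨c, rfl⟩ := hε.exists_eq_pull
    ((hT.self_orthogonal (T ⟶ M)).extensionsSplit hT.pd_le_one _ (hη.push hξ z))
  exact hε.pull_eq_zero_of_factors (Sigma.ι (fun _ : (T ⟶ M) => T) c) (by simp)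

end Tilting

end Extri


theorem corollary3p5 {C : Type u} [Category.{v} C] [Preadditive C] [HasZeroObject C] [HasBinaryBiproducts C]
    [HasCoproducts.{v} C] (𝓔 : Extri.ExtriangulatedStructure.{w} C) (hWIC : Extri.WIC 𝓔)
    (ξ : Set (Extri.ETriangle 𝓔)) (hξ : Extri.IsProperClass ξ)
    (hproj : Extri.EnoughXiProjectives ξ) (hinj : Extri.EnoughXiInjectives ξ)
    (hgen : Extri.XiProjectivesGenerate ξ) (T : C) (hT : Extri.IsXiTilting ξ T) :
    Extri.Pres₁ ξ T = Extri.Pres₂ ξ T := by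
  ext M
  refine ⟨hT.pres₂_of_pres₁ hWIC hξ hproj, ?_⟩
  rintro ⟨K, Y, hY, -, h⟩
  exact ⟨K, Y, hY, h⟩
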